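/- Theorem. For every $\varepsilon<1/2$ and every $C$ there is a constant $c>0$ such that the following holds. Let $(A,\le)$ be a totally ordered set with at least two elements, let $F\subseteq A^A$ be a monoid of functions under composition with $f(\min(x,y))=\min(f(x),f(y))$ for all $f\in F$ and $x,y\in A$, let the elements of $A$ be encoded injectively as bit strings, and let $n\ge 2$ and $0\le q\le Cn$ be integers. Consider any quantum algorithm that has access to an array $a[1..n]\in A^n$ only through the unitary oracle $\mathcal O_a|i,j,z\rangle=|i,j\oplus a[i],z\rangle$. Between its oracle calls it may apply arbitrary unitary operators independent of $a$, make measurements and prepare fresh states, and choose its further actions by arbitrary classical computation from the measurement outcomes; quantum and classical memory may be kept throughout. Suppose that, after an initialization, it processes online (it must answer each operation before it receives the next one) any sequence of $q$ operations, each being either - $\mathsf{Query}(l,r)$ with $1\le l\le r\le n$: output the smallest index $i\in[l,r]$ at which the current array attains its minimum over $[l,r]$; or - $\mathsf{Modify}(l,r,f)$ with $1\le l\le r\le n$ and $f\in F$: set $a[i]\leftarrow f(a[i])$ for all $l\le i\le r$, and that, for every initial array and every sequence of $q$ operations, with probability at least $1-\varepsilon$ all its answers are correct. Then its query complexity, i.e.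 the largest total number of calls to $\mathcal O_a$ (initialization included) over all operation sequences and measurement outcomes, is at least $c\sqrt{nq}$. -/

import Mathlib

open scoped ENNReal

universe u

namespace QRMQ

/-! ## The quantum register and its elementary operations -/

/-- Labels of the computational basis states `|i, j, z⟩`: an index `i` into the array, a string `j`
of bits (indexed by `β`) able to hold an array element, and the content `z` of the rest of the
memory. The bit positions `β` and the work labels `Z` are arbitrary, finite or not. -/
abbrev Register (n : ℕ) (β Z : Type u) : Type u := Fin n × (β → Bool) × Z

/-- The Hilbert space with orthonormal basis `|i, j, z⟩`. -/
abbrev QState (n : ℕ) (β Z : Type u) : Type u := lp (fun _ : Register n β Z => ℂ) 2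

variable {n : ℕ} {β Z : Type u}

open Classical in
/-- The computational basis state `|b⟩`. -/
noncomputable def basisState (b : Register n β Z) : QState n β Z :=
  lp.single 2 b (1 : ℂ)

theorem memlp_comp {ι : Type u} (σ : Equiv.Perm ι) (ψ : lp (fun _ : ι => ℂ) 2) :
    Memℓp (fun b => ψ (σ b)) 2 := by
  have h2 : 0 < (2 : ℝ≥0∞).toReal := by norm_num
  have h := (memℓp_gen_iff h2).1 (lp.memℓp ψ)
  exact memℓp_gen ((Equiv.summable_iff σ).2 h)

/-- The unitary operator that permutes the basis states, `|b⟩ ↦ |σ b⟩`. -/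
noncomputable def permUnitary {ι : Type u} (σ : Equiv.Perm ι) :
    lp (fun _ : ι => ℂ) 2 ≃ₗᵢ[ℂ] lp (fun _ : ι => ℂ) 2 where
  toFun ψ := ⟨fun b => ψ (σ.symm b), memlp_comp σ.symm ψ⟩
  invFun ψ := ⟨fun b => ψ (σ b), memlp_comp σ ψ⟩
  map_add' _ _ := rfl
  map_smul' _ _ := rfl
  left_inv ψ := by ext b; exact congrArg ψ (σ.symm_apply_apply b)
  right_inv ψ := by ext b; exact congrArg ψ (σ.apply_symm_apply b)
  norm_map' ψ := by
    have h2 : 0 < (2 : ℝ≥0∞).toReal := by norm_num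
    rw [lp.norm_eq_tsum_rpow h2, lp.norm_eq_tsum_rpow h2]
    congr 1
    exact Equiv.tsum_eq σ.symm (fun b => ‖ψ b‖ ^ (2 : ℝ≥0∞).toReal)

/-- The permutation `(i, j, z) ↦ (i, j ⊕ x i, z)` of the basis labels, `⊕` being bitwise XOR. -/
def oraclePerm (x : Fin n → β → Bool) : Equiv.Perm (Register n β Z) where
  toFun b := (b.1, fun t => xor (b.2.1 t) (x b.1 t), b.2.2)
  invFun b := (b.1, fun t => xor (b.2.1 t) (x b.1 t), b.2.2)
  left_inv b := by simp
  right_inv b := by simp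

/-- The quantum oracle `|i, j, z⟩ ↦ |i, j ⊕ x i, z⟩`. -/
noncomputable def oracle (x : Fin n → β → Bool) : QState n β Z ≃ₗᵢ[ℂ] QState n β Z :=
  permUnitary (oraclePerm x)

open Classical in
/-- The orthogonal projection onto the span of the basis states `|b⟩` with `p b = d`. -/
noncomputable def project {D : Type u} (p : Register n β Z → D) (d : D) (ψ : QState n β Z) :
    QState n β Z :=
  ⟨fun b => if p b = d then ψ b else 0, by
    have h2 : 0 < (2 : ℝ≥0∞).toReal := by norm_num
    refine memℓp_gen (((memℓp_gen_iff h2).1 (lp.memℓp ψ)).of_nonneg_of_le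
      (fun b => by positivity) (fun b => ?_))
    split_ifs
    · exact le_rfl
    · rw [norm_zero, Real.zero_rpow h2.ne']; positivity⟩

/-! ## Quantum procedures

A procedure interleaves unitary gates, oracle queries, measurements and preparations, and finally
returns a classical value. Everything after a measurement may depend in an arbitrary way on the
classical outcome, so arbitrary classical computation between the quantum steps is included.
A hybrid sequence `B₀ → A₁ → B₁ → ⋯ → A_m → B_m` of classical algorithms `B_i` and quantum query
circuits `A_i = U_T O ⋯ O U_0` is the case in which every `A_i` starts with `prepare` and ends
with `measure`; more generally quantum memory may be kept throughout. -/

/-- Procedures returning a value of type `R`. -/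
inductive Proc (n : ℕ) (β Z : Type u) (R : Type (u + 1)) : Type (u + 1)
  /-- Stop and return a classical value. -/
  | ret (r : R) : Proc n β Z R
  /-- Apply a unitary operator that is independent of the oracle. -/
  | gate (U : QState n β Z ≃ₗᵢ[ℂ] QState n β Z) (next : Proc n β Z R) : Proc n β Z R
  /-- Apply the oracle once. -/
  | query (next : Proc n β Z R) : Proc n β Z R
  /-- Measure, in the computational basis, the part `p b` of the label `b`, and continue
  according to the outcome. -/
  | measure {D : Type u} (p : Register n β Z → D) (next : D → Proc n β Z R) : Proc n β Z R
  /-- Discard the quantum state and prepare the basis state `|b⟩` instead. -/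
  | prepare (b : Register n β Z) (next : Proc n β Z R) : Proc n β Z R

namespace Proc

variable {R : Type (u + 1)}

/-- Execution of a procedure with the oracle for `x`, started in the unnormalized state `ψ`:
the squared norm of the state is the probability that the present branch of the computation is
reached, and the sum, over all terminating branches, of `K r φ` is formed, where `r` is the value
returned and `φ` the unnormalized final state of the branch. -/
noncomputable def eval (x : Fin n → β → Bool) (K : R → QState n β Z → ℝ≥0∞) :
    Proc n β Z R → QState n β Z → ℝ≥0∞
  | ret r, ψ => K r ψ
  | gate U next, ψ => eval x K next (U ψ)
  | query next, ψ => eval x K next (oracle x ψ)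
  | measure p next, ψ => ∑' d, eval x K (next d) (project p d ψ)
  | prepare b next, ψ => eval x K next ((‖ψ‖ : ℂ) • basisState b)

/-- The largest number of oracle queries on any branch of the computation, where `c r` further
queries are charged to a branch that returns `r`. -/
noncomputable def queries (c : R → ℕ∞) : Proc n β Z R → ℕ∞
  | ret r => c r
  | gate _ next => queries c next
  | query next => 1 + queries c next
  | measure _ next => ⨆ d, queries c (next d)
  | prepare _ next => queries c next

end Proc

/-! ## The dynamic range minimum problem -/

/-- The operations on an array `a` of length `n` (indexed from `0`) with elements in `A`:
`query l r` asks for the index of the minimum of `a l, …, a r`, and `modify l r f` replaces `a i`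
by `f (a i)` for `l ≤ i ≤ r`. The modifications `f` are drawn from a monoid `F` of functions. -/
inductive Op (n : ℕ) {A : Type u} (F : Submonoid (Function.End A)) : Type u
  | query (l r : Fin n) (h : l ≤ r) : Op n F
  | modify (l r : Fin n) (h : l ≤ r) (f : F) : Op n F

namespace Op

variable {A : Type u} {F : Submonoid (Function.End A)}

/-- What the data structure has to output for an operation: an index for a query, nothing for a
modification. -/
abbrev Answer : Op n F → Type
  | query _ _ _ => Fin n
  | modify _ _ _ _ => Unit

/-- `RMQ(a, l, r) = i`: the element `a i` is the minimum of `a l, …, a r`, and `i` is the smallest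
index at which it occurs. -/
def IsRMQ [LinearOrder A] (a : Fin n → A) (l r i : Fin n) : Prop :=
  i ∈ Set.Icc l r ∧ (∀ j ∈ Set.Icc l r, a i ≤ a j) ∧ ∀ j ∈ Set.Icc l r, a j = a i → i ≤ j

/-- Correctness of the output when `a` is the current array. -/
def Correct [LinearOrder A] (a : Fin n → A) : (o : Op n F) → o.Answer → Prop
  | query l r _, i => IsRMQ a l r i
  | modify _ _ _ _, _ => True

/-- The array after the operation. -/
def apply (a : Fin n → A) : Op n F → Fin n → A
  | query _ _ _ => a
  | modify l r _ f => fun i => if l ≤ i ∧ i ≤ r then (f : Function.End A) (a i) else a i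

end Op

variable {A : Type u} {F : Submonoid (Function.End A)}

/-- An online data structure that is ready to process `q` more operations: it is handed the next
operation, runs a procedure, and must output the answer to that operation before it receives the
next one. The quantum state is kept in between, and so is all classical information. -/
def Online (n : ℕ) {A : Type u} (F : Submonoid (Function.End A)) (β Z : Type u) :
    ℕ → Type (u + 1)
  | 0 => PUnit
  | q + 1 => (o : Op n F) → Proc n β Z (o.Answer × Online n F β Z q)

namespace Online

open Classical in
/-- The weight of the branches on which all operations of the list `ops` are answered correctly.
Here `x` is the oracle string, which belongs to the initial array and never changes, `a` is the
current array, and `ψ` is the current unnormalized state. -/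
noncomputable def success [LinearOrder A] (x : Fin n → β → Bool) :
    (q : ℕ) → Online n F β Z q → (Fin n → A) → (Fin q → Op n F) → QState n β Z → ℝ≥0∞
  | 0, _, _, _, ψ => ENNReal.ofReal (‖ψ‖ ^ 2)
  | q + 1, D, a, ops, ψ =>
      (D (ops 0)).eval x
        (fun s φ =>
          if (ops 0).Correct a s.1 then
            success x q s.2 ((ops 0).apply a) (fun t => ops t.succ) φ
          else 0)
        ψ

/-- The largest number of oracle queries over all operations and measurement outcomes. -/
noncomputable def queries : (q : ℕ) → Online n F β Z q → ℕ∞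
  | 0, _ => 0
  | q + 1, D => ⨆ o : Op n F, (D o).queries (fun s => queries q s.2)

end Online

/-- A quantum algorithm for dynamic range minimum queries that processes `q` operations on an array
of length `n`: the memory starts in a basis state, and an initialization procedure (which may query
the oracle) returns an online data structure. -/
structure Algorithm (n q : ℕ) {A : Type u} (F : Submonoid (Function.End A)) (β Z : Type u) where
  start : Register n β Z
  init : Proc n β Z (Online n F β Z q)

namespace Algorithm

variable {q : ℕ}

/-- The probability that all the operations `ops` are answered correctly when the initial array
is `a`, whose elements are stored as bit strings by `enc`. -/
noncomputable def successProb [LinearOrder A] (alg : Algorithm n q F β Z) (enc : A ↪ (β → Bool))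
    (a : Fin n → A) (ops : Fin q → Op n F) : ℝ≥0∞ :=
  alg.init.eval (fun i => enc (a i))
    (fun D φ => D.success (fun i => enc (a i)) q a ops φ) (basisState alg.start)

/-- On every initial array and every sequence of `q` operations, all the answers are correct with
probability at least `1 - ε`. -/
def Supports [LinearOrder A] (alg : Algorithm n q F β Z) (enc : A ↪ (β → Bool)) (ε : ℝ) : Prop :=
  ∀ (a : Fin n → A) (ops : Fin q → Op n F),
    ENNReal.ofReal (1 - ε) ≤ alg.successProb enc a ops

/-- The worst-case total number of oracle queries, initialization included. -/
noncomputable def queryComplexity (alg : Algorithm n q F β Z) : ℕ∞ :=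
  alg.init.queries (fun D => D.queries q)

end Algorithm

end QRMQ

namespace QRMQ

variable {n : ℕ} {β Z : Type u}


/-! ## Inner products under measurements and oracle calls -/

/-! Range minimum queries alone are already hard. Cut the array into `k ≤ q` blocks of length `m`,
each with one element `lo` at an unknown position and `hi` elsewhere, and query each block: correct
answers reveal all `k` positions. This costs about `k √m` oracle calls, which is of order `√(nq)`
for `k = min q (n / 2)` and `m = n / k`.

The cost comes from an adversary argument. Pair the inputs that differ in exactly one block. The
summed overlap of paired states starts at the number of pairs, each oracle call lowers it by at most
`speed` times the total weight, and success forces it to be small at the end. `Adversary.Bounds`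
states this for unnormalized states with success weights inside, and both sides are homogeneous of
degree two. So branches of a measurement simply add up, and the invariant passes by induction
through every procedure (`bounds_eval`) and every online operation (`bounds_success`).
`BlockSearch.sum_mul_le` supplies the speed `2 √(m - 1)` against the degree `k (m - 1)`. -/

open Classical in
theorem project_apply {D : Type u} (p : Register n β Z → D) (d : D) (ψ : QState n β Z)
    (b : Register n β Z) : project p d ψ b = if p b = d then ψ b else 0 := rfl

theorem oracle_apply (x : Fin n → β → Bool) (ψ : QState n β Z) (b : Register n β Z) :
    oracle x ψ b = ψ ((oraclePerm x).symm b) := rfl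

theorem hasSum_inner_project {D : Type u} (p : Register n β Z → D) (ψ φ : QState n β Z) :
    HasSum (fun d => inner ℂ (project p d ψ) (project p d φ)) (inner ℂ ψ φ) := by
  classical
  have h := (lp.hasSum_inner (𝕜 := ℂ) ψ φ).tsum_fiberwise p
  have hd (d : D) : inner ℂ (project p d ψ) (project p d φ) =
      ∑' b : p ⁻¹' {d}, inner ℂ (ψ b) (φ b) := by
    rw [tsum_subtype (p ⁻¹' {d}) (fun b => inner ℂ (ψ b) (φ b)), lp.inner_eq_tsum]
    congr 1
    ext b
    by_cases hb : p b = d <;> simp [project_apply, hb]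
  simpa only [hd] using h

/-- Triangle inequality over the outcomes: a measurement never lowers the summed overlap, so it
makes no progress for the algorithm. -/
theorem ofReal_norm_inner_le_tsum_project {D : Type u} (p : Register n β Z → D)
    (ψ φ : QState n β Z) :
    ENNReal.ofReal ‖inner ℂ ψ φ‖ ≤
      ∑' d, ENNReal.ofReal ‖inner ℂ (project p d ψ) (project p d φ)‖ := by
  rw [← (hasSum_inner_project p ψ φ).tsum_eq]
  simp only [ofReal_norm]
  exact enorm_tsum_le_tsum_enorm

theorem hasSum_norm_sq_project {D : Type u} (p : Register n β Z → D) (ψ : QState n β Z) :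
    HasSum (fun d => ‖project p d ψ‖ ^ 2) (‖ψ‖ ^ 2) := by
  have h := hasSum_inner_project p ψ ψ
  simp only [inner_self_eq_norm_sq_to_K] at h
  exact_mod_cast h

theorem tsum_ofReal_norm_sq_project {D : Type u} (p : Register n β Z → D) (ψ : QState n β Z) :
    ∑' d, ENNReal.ofReal (‖project p d ψ‖ ^ 2) = ENNReal.ofReal (‖ψ‖ ^ 2) := by
  have h := hasSum_norm_sq_project p ψ
  rw [← h.tsum_eq, ENNReal.ofReal_tsum_of_nonneg (fun _ => by positivity) h.summable]

/-- The component of a state on the basis states with array index `i`. -/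
noncomputable def indexPart (i : Fin n) (ψ : QState n β Z) : QState n β Z :=
  project (fun b => ULift.up.{u} b.1) (ULift.up i) ψ

theorem inner_eq_sum_indexPart (ψ φ : QState n β Z) :
    inner ℂ ψ φ = ∑ i, inner ℂ (indexPart i ψ) (indexPart i φ) := by
  rw [← (hasSum_inner_project (fun b => ULift.up.{u} b.1) ψ φ).tsum_eq, tsum_fintype]
  exact (Equiv.sum_comp (Equiv.ulift.{u} (α := Fin n)).symm _).symm

theorem sum_norm_sq_indexPart (ψ : QState n β Z) :
    ∑ i, ‖indexPart i ψ‖ ^ 2 = ‖ψ‖ ^ 2 := by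
  rw [← (hasSum_norm_sq_project (fun b => ULift.up.{u} b.1) ψ).tsum_eq, tsum_fintype]
  exact Equiv.sum_comp (Equiv.ulift.{u} (α := Fin n)).symm
    (fun d => ‖project (fun b => ULift.up.{u} b.1) d ψ‖ ^ 2)

theorem indexPart_oracle (x : Fin n → β → Bool) (i : Fin n) (ψ : QState n β Z) :
    indexPart i (oracle x ψ) = oracle x (indexPart i ψ) := by
  ext b
  simp only [indexPart, project_apply, oracle_apply]
  congr 1

theorem oracle_indexPart_congr {x y : Fin n → β → Bool} {i : Fin n} (h : x i = y i)
    (ψ : QState n β Z) : oracle x (indexPart i ψ) = oracle y (indexPart i ψ) := by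
  ext b
  obtain ⟨j, s, z⟩ := b
  simp only [indexPart, project_apply, oracle_apply, oraclePerm, Equiv.coe_fn_symm_mk]
  by_cases hj : j = i
  · subst hj; simp [h]
  · simp [hj]

-- Split by array index. Where `x` and `y` agree, both oracles act as the same isometry and the term
-- is unchanged; elsewhere Cauchy–Schwarz before and after the call gives the factor 2.
open Classical in
theorem norm_inner_le_norm_inner_oracle (x y : Fin n → β → Bool) (ψ φ : QState n β Z) :
    ‖inner ℂ ψ φ‖ ≤ ‖inner ℂ (oracle x ψ) (oracle y φ)‖ +
      ∑ i with x i ≠ y i, 2 * (‖indexPart i ψ‖ * ‖indexPart i φ‖) := by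
  have key : ‖inner ℂ ψ φ - inner ℂ (oracle x ψ) (oracle y φ)‖ ≤
      ∑ i with x i ≠ y i, 2 * (‖indexPart i ψ‖ * ‖indexPart i φ‖) := by
    rw [inner_eq_sum_indexPart ψ, inner_eq_sum_indexPart (oracle x ψ),
      ← Finset.sum_sub_distrib, Finset.sum_filter]
    refine (norm_sum_le _ _).trans (Finset.sum_le_sum fun i _ => ?_)
    rw [indexPart_oracle, indexPart_oracle]
    split_ifs with h
    · refine (norm_sub_le _ _).trans ?_
      have h1 := norm_inner_le_norm (𝕜 := ℂ) (indexPart i ψ) (indexPart i φ)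
      have h2 := norm_inner_le_norm (𝕜 := ℂ) (oracle x (indexPart i ψ))
        (oracle y (indexPart i φ))
      rw [LinearIsometryEquiv.norm_map, LinearIsometryEquiv.norm_map] at h2
      linarith
    · rw [← oracle_indexPart_congr (not_not.1 h), LinearIsometryEquiv.inner_map_map, sub_self,
        norm_zero]
  have := norm_sub_norm_le (inner ℂ ψ φ) (inner ℂ (oracle x ψ) (oracle y φ))
  linarith

theorem norm_basisState (b : Register n β Z) : ‖basisState b‖ = 1 := by
  classical
  simp [basisState, lp.norm_single]

/-! ## The adversary bound -/

open Classical in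
/-- The data of an adversary argument: inputs `x : X` with oracle strings `inp x`, and finitely
many pairs `(src p, tgt p)` of inputs that the algorithm has to tell apart. -/
structure Adversary (n : ℕ) (β : Type u) where
  X : Type
  P : Type
  [fintypeX : Fintype X]
  pairs : Finset P
  src : P → X
  tgt : P → X
  inp : X → Fin n → β → Bool
  /-- The number of pairs that contain a given input on a given side. -/
  degree : ℕ
  sum_src (g : X → ℝ) : ∑ p ∈ pairs, g (src p) = degree * ∑ x, g x
  sum_tgt (g : X → ℝ) : ∑ p ∈ pairs, g (tgt p) = degree * ∑ x, g x
  /-- An upper bound for the progress made by one query. -/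
  speed : ℝ
  speed_nonneg : 0 ≤ speed
  -- To be applied with `w x i` the norm of the part of the state on `x` with array index `i`; for
  -- arbitrary weights the condition is purely combinatorial.
  query_le (w : X → Fin n → ℝ) (hw : ∀ x i, 0 ≤ w x i) :
    ∑ p ∈ pairs, ∑ i with inp (src p) i ≠ inp (tgt p) i,
    2 * (w (src p) i * w (tgt p) i) ≤ speed * ∑ x, ∑ i, w x i ^ 2

attribute [instance] Adversary.fintypeX

namespace Adversary

variable (G : Adversary n β)

/-- The sum of the overlaps of the states that belong to the pairs of inputs. -/
noncomputable def overlap (ψ : G.X → QState n β Z) : ℝ≥0∞ :=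
  ∑ p ∈ G.pairs, ENNReal.ofReal ‖inner ℂ (ψ (G.src p)) (ψ (G.tgt p))‖

/-- The total weight of a family of states. -/
noncomputable def weight (ψ : G.X → QState n β Z) : ℝ≥0∞ :=
  ∑ x, ENNReal.ofReal (‖ψ x‖ ^ 2)

/-- `V x ψ` is bounded as the success weight of an algorithm with `T` queries is, which runs on
input `x` from the state `ψ`. -/
def Bounds (ρ : ℝ) (T : ℕ∞) (V : G.X → QState n β Z → ℝ≥0∞) : Prop :=
  ∀ ψ : G.X → QState n β Z,
    G.overlap ψ + ENNReal.ofReal (2 * G.degree * (ρ - 1 / (4 * ρ))) * ∑ x, V x (ψ x) ≤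
      (ENNReal.ofReal (2 * G.degree * ρ) + ENNReal.ofReal G.speed * T) * G.weight ψ

variable {G} {ρ : ℝ}

theorem Bounds.mono {T T' : ℕ∞} {V V' : G.X → QState n β Z → ℝ≥0∞} (h : G.Bounds ρ T V)
    (hT : T ≤ T') (hV : ∀ x ψ, V' x ψ ≤ V x ψ) : G.Bounds ρ T' V' := by
  intro ψ
  have hT' : (T : ℝ≥0∞) ≤ T' := ENat.toENNReal_le.2 hT
  calc _ ≤ _ := by gcongr with x; exact hV x _
    _ ≤ _ := h ψ
    _ ≤ _ := by gcongr

/-! ### Propagation of the invariant through procedures. -/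

theorem overlap_le_oracle (ψ : G.X → QState n β Z) :
    G.overlap ψ ≤ G.overlap (fun x => oracle (G.inp x) (ψ x)) +
      ENNReal.ofReal G.speed * G.weight ψ := by
  have hw := G.query_le (fun x i => ‖indexPart i (ψ x)‖) fun _ _ => norm_nonneg _
  simp only [sum_norm_sq_indexPart] at hw
  rw [overlap, overlap, weight, ← ENNReal.ofReal_sum_of_nonneg (fun _ _ => by positivity),
    ← ENNReal.ofReal_sum_of_nonneg (fun _ _ => by positivity),
    ← ENNReal.ofReal_sum_of_nonneg (fun _ _ => by positivity),
    ← ENNReal.ofReal_mul G.speed_nonneg, ← ENNReal.ofReal_add (by positivity)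
      (mul_nonneg G.speed_nonneg (by positivity))]
  refine ENNReal.ofReal_le_ofReal ?_
  refine le_trans ?_ (add_le_add_right hw _)
  rw [← Finset.sum_add_distrib]
  exact Finset.sum_le_sum fun p _ => norm_inner_le_norm_inner_oracle _ _ _ _

theorem bounds_eval {R : Type (u + 1)} {c : R → ℕ∞} {K : G.X → R → QState n β Z → ℝ≥0∞}
    (hK : ∀ r, G.Bounds ρ (c r) (fun x => K x r)) (P : Proc n β Z R) :
    G.Bounds ρ (P.queries c) (fun x => P.eval (G.inp x) (K x)) := by
  induction P with
  | ret r => exact hK r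
  | gate U next ih =>
    intro ψ
    have h := ih fun x => U (ψ x)
    simpa only [overlap, weight, LinearIsometryEquiv.inner_map_map,
      LinearIsometryEquiv.norm_map, Proc.eval, Proc.queries] using h
  | query next ih =>
    intro ψ
    have h := ih fun x => oracle (G.inp x) (ψ x)
    have hw : G.weight (fun x => oracle (G.inp x) (ψ x)) = G.weight ψ := by
      simp only [weight, LinearIsometryEquiv.norm_map]
    rw [hw] at h
    simp only [Proc.eval, Proc.queries, ENat.toENNReal_add, ENat.toENNReal_one]
    calc _ ≤ _ := add_le_add_left (overlap_le_oracle ψ) _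
      _ = _ := add_right_comm _ _ _
      _ ≤ _ := add_le_add_left h _
      _ = _ := by ring
  | measure p next ih =>
    intro ψ
    simp only [Proc.eval, Proc.queries]
    have hS : G.overlap ψ ≤ ∑' d, G.overlap (fun x => project p d (ψ x)) := by
      simp only [overlap]
      rw [Summable.tsum_finsetSum fun _ _ => ENNReal.summable]
      exact Finset.sum_le_sum fun _ _ => ofReal_norm_inner_le_tsum_project p _ _
    have hw : G.weight ψ = ∑' d, G.weight (fun x => project p d (ψ x)) := by
      simp only [weight]
      rw [Summable.tsum_finsetSum fun _ _ => ENNReal.summable]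
      simp only [tsum_ofReal_norm_sq_project]
    rw [hw, ← Summable.tsum_finsetSum fun _ _ => ENNReal.summable, ← ENNReal.tsum_mul_left,
      ← ENNReal.tsum_mul_left]
    refine (add_le_add_left hS _).trans ?_
    rw [← ENNReal.tsum_add]
    exact ENNReal.tsum_le_tsum fun d =>
      (ih d).mono (le_iSup (fun d => (next d).queries c) d) (fun _ _ => le_rfl) _
  | prepare b next ih =>
    intro ψ
    have h := ih fun x => (‖ψ x‖ : ℂ) • basisState b
    have hw : G.weight (fun x => (‖ψ x‖ : ℂ) • basisState b) = G.weight ψ := by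
      simp only [weight, norm_smul, norm_basisState, Complex.norm_real, norm_norm, mul_one]
    -- After a preparation all states are parallel, so Cauchy–Schwarz becomes an equality and the
    -- overlap can only grow.
    have hS : G.overlap ψ ≤ G.overlap (fun x => (‖ψ x‖ : ℂ) • basisState b) := by
      refine Finset.sum_le_sum fun p _ => ENNReal.ofReal_le_ofReal ?_
      refine (norm_inner_le_norm _ _).trans_eq ?_
      simp only [inner_smul_left, inner_smul_right, inner_self_eq_norm_sq_to_K, norm_basisState]
      simp [mul_comm]
    rw [hw] at h
    exact (add_le_add_left hS _).trans h

/-! ### The invariant at the end of the computation, and the resulting bound. -/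

theorem mul_add_le_of_half_le (hρ : 1 / 2 < ρ) (a b : ℝ) (s t : Prop) [Decidable s] [Decidable t]
    (hst : ¬(s ∧ t)) :
    a * b + (ρ - 1 / (4 * ρ)) * ((if s then a ^ 2 else 0) + (if t then b ^ 2 else 0)) ≤
      ρ * (a ^ 2 + b ^ 2) := by
  have key (a b : ℝ) : a * b ≤ 1 / (4 * ρ) * a ^ 2 + ρ * b ^ 2 := by
    have : 1 / (4 * ρ) * a ^ 2 + ρ * b ^ 2 - a * b = (a - 2 * ρ * b) ^ 2 / (4 * ρ) := by
      field_simp; ring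
    have h0 : 0 ≤ (a - 2 * ρ * b) ^ 2 / (4 * ρ) := by positivity
    linarith
  by_cases hs : s <;> by_cases ht : t
  · exact absurd ⟨hs, ht⟩ hst
  · simp only [hs, ht, if_true, if_false]; linarith [key a b]
  · simp only [hs, ht, if_true, if_false]; linarith [key b a]
  · simp only [hs, ht, if_false]; nlinarith [sq_nonneg (a - b), sq_nonneg a, sq_nonneg b]

open Classical in
/-- Without further queries, no algorithm succeeds on both inputs of a pair. -/
theorem bounds_norm_sq (hρ : 1 / 2 < ρ) (L : Set G.X)
    (hL : ∀ p ∈ G.pairs, ¬(G.src p ∈ L ∧ G.tgt p ∈ L)) :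
    G.Bounds (Z := Z) ρ 0 (fun x ψ => if x ∈ L then ENNReal.ofReal (‖ψ‖ ^ 2) else 0) := by
  intro ψ
  have hμ : 0 ≤ ρ - 1 / (4 * ρ) := by
    have : ρ - 1 / (4 * ρ) = (2 * ρ - 1) * (2 * ρ + 1) / (4 * ρ) := by field_simp; ring
    rw [this]
    have : 0 ≤ 2 * ρ - 1 := by linarith
    positivity
  have hsum : ∑ x, (if x ∈ L then ENNReal.ofReal (‖ψ x‖ ^ 2) else 0) =
      ENNReal.ofReal (∑ x, if x ∈ L then ‖ψ x‖ ^ 2 else 0) := by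
    rw [ENNReal.ofReal_sum_of_nonneg fun x _ => by split_ifs <;> positivity]
    exact Finset.sum_congr rfl fun x _ => by split_ifs <;> simp
  have hnn : 0 ≤ ∑ x, if x ∈ L then ‖ψ x‖ ^ 2 else 0 :=
    Finset.sum_nonneg fun x _ => by split_ifs <;> positivity
  simp only [ENat.toENNReal_zero, mul_zero, add_zero]
  rw [hsum, overlap, weight, ← ENNReal.ofReal_sum_of_nonneg (fun _ _ => by positivity),
    ← ENNReal.ofReal_sum_of_nonneg (fun _ _ => by positivity),
    ← ENNReal.ofReal_mul (by positivity), ← ENNReal.ofReal_mul (by positivity),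
    ← ENNReal.ofReal_add (by positivity) (by positivity)]
  refine ENNReal.ofReal_le_ofReal ?_
  have h1 := G.sum_src fun x => if x ∈ L then ‖ψ x‖ ^ 2 else 0
  have h2 := G.sum_tgt fun x => if x ∈ L then ‖ψ x‖ ^ 2 else 0
  have h3 := G.sum_src fun x => ‖ψ x‖ ^ 2
  have h4 := G.sum_tgt fun x => ‖ψ x‖ ^ 2
  have h := Finset.sum_le_sum fun p hp =>
    (add_le_add_left (norm_inner_le_norm (𝕜 := ℂ) (ψ (G.src p)) (ψ (G.tgt p))) _).trans
      (mul_add_le_of_half_le hρ ‖ψ (G.src p)‖ ‖ψ (G.tgt p)‖ _ _ (hL p hp))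
  rw [Finset.sum_add_distrib, ← Finset.mul_sum, ← Finset.mul_sum, Finset.sum_add_distrib,
    Finset.sum_add_distrib, h1, h2, h3, h4] at h
  linarith

variable {A : Type u} [LinearOrder A] {F : Submonoid (Function.End A)}

open Classical in
/-- If the inputs of every pair in `L` are told apart by one of the remaining range minimum
queries, then the success weights on the inputs in `L` are bounded. -/
theorem bounds_success (hρ : 1 / 2 < ρ) (a : G.X → Fin n → A) (q : ℕ)
    (D : Online n F β Z q) (l r : Fin q → Fin n) (h : ∀ t, l t ≤ r t) (L : Set G.X)
    (hL : ∀ p ∈ G.pairs, G.src p ∈ L → G.tgt p ∈ L → ∃ t, ∀ i,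
      ¬(Op.IsRMQ (a (G.src p)) (l t) (r t) i ∧ Op.IsRMQ (a (G.tgt p)) (l t) (r t) i)) :
    G.Bounds ρ (Online.queries q D) (fun x ψ => if x ∈ L then
        Online.success (G.inp x) q D (a x) (fun t => Op.query (l t) (r t) (h t)) ψ else 0) := by
  induction q generalizing L with
  | zero =>
    refine bounds_norm_sq hρ L fun p hp hpL => ?_
    obtain ⟨t, -⟩ := hL p hp hpL.1 hpL.2
    exact t.elim0
  | succ q ih =>
    let o : Op n F := Op.query (l 0) (r 0) (h 0)
    -- Only inputs for which the answer given is correct survive. If both members of a pair survive,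
    -- the current query did not separate them, so a later one must.
    let K (x : G.X) (s : o.Answer × Online n F β Z q) (φ : QState n β Z) : ℝ≥0∞ :=
      if x ∈ L ∧ o.Correct (a x) s.1 then Online.success (G.inp x) q s.2 (a x)
        (fun t => Op.query (l t.succ) (r t.succ) (h t.succ)) φ else 0
    have hK (s : o.Answer × Online n F β Z q) :
        G.Bounds ρ (Online.queries q s.2) (fun x => K x s) := by
      refine (ih s.2 (fun t => l t.succ) (fun t => r t.succ) (fun t => h t.succ)
        {x | x ∈ L ∧ o.Correct (a x) s.1} fun p hp hx hy => ?_).mono le_rfl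
        fun x φ => by
          by_cases hs : x ∈ L ∧ o.Correct (a x) s.1 <;> simp [K, hs]
      obtain ⟨t, ht⟩ := hL p hp hx.1 hy.1
      cases t using Fin.cases with
      | zero => exact absurd (And.intro hx.2 hy.2) (ht s.1)
      | succ t => exact ⟨t, ht⟩
    have hev := bounds_eval (c := fun s => Online.queries q s.2) hK (D o)
    refine hev.mono (le_iSup (fun o => (D o).queries fun s => Online.queries q s.2) o)
      fun x ψ => ?_
    by_cases hx : x ∈ L
    · simp only [K, hx, if_true, true_and]
      exact le_rfl
    · simp [hx]

/-- The adversary lower bound for range minimum queries that tell the inputs of every pair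
apart. -/
theorem le_queryComplexity [Nonempty G.X] {q : ℕ} {ε : ℝ} (hε : ε < 1 / 2)
    (enc : A ↪ (β → Bool)) (a : G.X → Fin n → A) (ha : ∀ x i, G.inp x i = enc (a x i))
    (l r : Fin q → Fin n) (h : ∀ t, l t ≤ r t)
    (hsep : ∀ p ∈ G.pairs, ∃ t, ∀ i,
      ¬(Op.IsRMQ (a (G.src p)) (l t) (r t) i ∧ Op.IsRMQ (a (G.tgt p)) (l t) (r t) i))
    (alg : Algorithm n q F β Z) (halg : alg.Supports enc ε) {T : ℕ}
    (hT : alg.queryComplexity = T) :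
    G.degree * ((1 - 2 * ε) ^ 2 / 2) ≤ G.speed * T := by
  classical
  have hinp (x : G.X) : (fun i => enc (a x i)) = G.inp x := funext fun i => (ha x i).symm
  have hρ : 1 / 2 < 1 - ε := by linarith
  have hN : (0 : ℝ) < Fintype.card G.X := by exact_mod_cast Fintype.card_pos
  have hB := bounds_eval (G := G) (ρ := 1 - ε) (c := fun D => Online.queries q D)
    (K := fun x D φ => Online.success (G.inp x) q D (a x)
      (fun t => Op.query (l t) (r t) (h t)) φ)
    (fun D => (bounds_success hρ a q D l r h Set.univ fun p hp _ _ => hsep p hp).mono le_rfl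
      fun x ψ => by simp) alg.init (fun _ => basisState alg.start)
  have hsucc (x : G.X) : ENNReal.ofReal (1 - ε) ≤ alg.init.eval (G.inp x)
      (fun D φ => Online.success (G.inp x) q D (a x)
        (fun t => Op.query (l t) (r t) (h t)) φ) (basisState alg.start) := by
    have := halg (a x) (fun t => Op.query (l t) (r t) (h t))
    rwa [Algorithm.successProb, hinp] at this
  change _ ≤ (_ + _ * ((alg.queryComplexity : ℕ∞) : ℝ≥0∞)) * _ at hB
  have hcard : (G.pairs.card : ℝ) = G.degree * Fintype.card G.X := by
    simpa using G.sum_src fun _ => 1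
  have hμ : 0 ≤ (1 - ε) - 1 / (4 * (1 - ε)) := by
    have : (1 - ε) - 1 / (4 * (1 - ε)) =
        (1 - 2 * ε) * (2 * (1 - ε) + 1) / (4 * (1 - ε)) := by
      have : 1 - ε ≠ 0 := by linarith
      field_simp; ring
    rw [this]
    have h1 : 0 ≤ 1 - 2 * ε := by linarith
    have h2 : 0 ≤ 1 - ε := by linarith
    positivity
  have hs := G.speed_nonneg
  have h1ε : 0 ≤ 1 - ε := by linarith
  have hfin := le_trans (add_le_add_right
    (mul_le_mul_right (Finset.sum_le_sum fun x (_ : x ∈ Finset.univ) => hsucc x)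
      (ENNReal.ofReal (2 * G.degree * ((1 - ε) - 1 / (4 * (1 - ε))))))
    (G.overlap fun _ => basisState alg.start)) hB
  simp only [overlap, weight, inner_self_eq_norm_sq_to_K, norm_basisState, hT,
    ENat.toENNReal_coe] at hfin
  rw [← ENNReal.ofReal_natCast T, ← ENNReal.ofReal_sum_of_nonneg (fun _ _ => by positivity),
    ← ENNReal.ofReal_sum_of_nonneg (fun _ _ => by positivity),
    ← ENNReal.ofReal_sum_of_nonneg (fun _ _ => by positivity),
    ← ENNReal.ofReal_mul (by positivity), ← ENNReal.ofReal_mul (by positivity),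
    ← ENNReal.ofReal_add (by positivity) (by positivity),
    ← ENNReal.ofReal_add (by positivity) (by positivity),
    ← ENNReal.ofReal_mul (by positivity), ENNReal.ofReal_le_ofReal_iff (by positivity)] at hfin
  simp only [Finset.sum_const, Finset.card_univ, nsmul_eq_mul, one_pow, norm_one, mul_one,
    RCLike.ofReal_one, hcard] at hfin
  -- With `ρ = 1 - ε`, what remains per unit of degree is `1 + (2ρ² - 1/2) - 2ρ = (1 - 2ε)² / 2`.
  have hρ' : 2 * ((1 - ε) - 1 / (4 * (1 - ε))) * (1 - ε) = 2 * (1 - ε) ^ 2 - 1 / 2 := by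
    have : 1 - ε ≠ 0 := by linarith
    field_simp; ring
  have hcancel : G.degree + G.degree * (2 * ((1 - ε) - 1 / (4 * (1 - ε))) * (1 - ε)) ≤
      2 * G.degree * (1 - ε) + G.speed * T := by
    refine le_of_mul_le_mul_right ?_ hN
    linarith
  rw [hρ'] at hcancel
  linarith

end Adversary


/-! ## Finding the minima of `k` blocks of length `m` -/

namespace BlockSearch

variable {k m : ℕ}

/-- The pairs `(x, y)` of choices of one position per block that differ in exactly one block are
coded as `(x, b, v)`, where `v ≠ x b` and `y` is `x` with `x b` replaced by `v`. -/
def pairs (k m : ℕ) : Finset ((Fin k → Fin m) × Fin k × Fin m) :=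
  {p | p.2.2 ≠ p.1 p.2.1}

/-- The second component of a coded pair. -/
def tgt (p : (Fin k → Fin m) × Fin k × Fin m) : Fin k → Fin m :=
  Function.update p.1 p.2.1 p.2.2

/-- Exchange of the two components of a coded pair. -/
def swap (p : (Fin k → Fin m) × Fin k × Fin m) : (Fin k → Fin m) × Fin k × Fin m :=
  (tgt p, p.2.1, p.1 p.2.1)

theorem swap_swap (p : (Fin k → Fin m) × Fin k × Fin m) : swap (swap p) = p := by
  simp [swap, tgt]

theorem swap_mem {p : (Fin k → Fin m) × Fin k × Fin m} (hp : p ∈ pairs k m) :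
    swap p ∈ pairs k m := by
  simpa [pairs, swap, tgt, eq_comm] using hp

theorem sum_swap (f : (Fin k → Fin m) × Fin k × Fin m → ℝ) :
    ∑ p ∈ pairs k m, f (swap p) = ∑ p ∈ pairs k m, f p :=
  Finset.sum_nbij' swap swap (fun _ => swap_mem) (fun _ => swap_mem) (fun p _ => swap_swap p)
    (fun p _ => swap_swap p) (fun _ _ => rfl)

theorem sum_pairs (f : (Fin k → Fin m) → Fin k → Fin m → ℝ) :
    ∑ p ∈ pairs k m, f p.1 p.2.1 p.2.2 =
      ∑ x, ∑ b, ((∑ v, f x b v) - f x b (x b)) := by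
  rw [pairs, Finset.sum_filter, Fintype.sum_prod_type]
  refine Finset.sum_congr rfl fun x _ => ?_
  rw [Fintype.sum_prod_type]
  refine Finset.sum_congr rfl fun b _ => ?_
  rw [eq_sub_iff_add_eq, ← Fintype.sum_ite_eq' (x b) (f x b), ← Finset.sum_add_distrib]
  exact Finset.sum_congr rfl fun v _ => by by_cases h : v = x b <;> simp [h]

theorem sum_fst (hm : 1 ≤ m) (g : (Fin k → Fin m) → ℝ) :
    ∑ p ∈ pairs k m, g p.1 = (k * (m - 1) : ℕ) * ∑ x, g x := by
  rw [sum_pairs (fun x _ _ => g x), Finset.mul_sum]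
  refine Finset.sum_congr rfl fun x _ => ?_
  simp only [Finset.sum_const, Finset.card_univ, Fintype.card_fin, nsmul_eq_mul]
  push_cast [hm]
  ring

/-- The effect of one query: the weights `u x b v` are those of the queries to position `v` of
block `b` on input `x`. -/
theorem sum_mul_le (hm : 2 ≤ m) (u : (Fin k → Fin m) → Fin k → Fin m → ℝ) :
    ∑ p ∈ pairs k m, (2 * (u p.1 p.2.1 (p.1 p.2.1) * u (tgt p) p.2.1 (p.1 p.2.1)) +
        2 * (u p.1 p.2.1 p.2.2 * u (tgt p) p.2.1 p.2.2)) ≤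
      2 * √((m : ℝ) - 1) * ∑ x, ∑ b, ∑ v, u x b v ^ 2 := by
  set s := √((m : ℝ) - 1)
  have hm' : (1 : ℝ) ≤ m - 1 := by
    have : (2 : ℝ) ≤ m := by exact_mod_cast hm
    linarith
  have hs : 0 < s := Real.sqrt_pos.2 (by linarith)
  have hs2 : s * s = m - 1 := Real.mul_self_sqrt (by linarith)
  have amgm (a b : ℝ) : 2 * (a * b) ≤ a ^ 2 / s + s * b ^ 2 := by
    have h : a ^ 2 / s + s * b ^ 2 - 2 * (a * b) = (a - s * b) ^ 2 / s := by field_simp; ring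
    have : 0 ≤ (a - s * b) ^ 2 / s := by positivity
    linarith
  -- `f p` collects the terms of the first input, `f (swap p)` those of the second. Each marked
  -- position occurs in `m - 1` pairs and each other position in one; the weights `1 / s` and `s`
  -- balance these, as `(m - 1) / s = s`.
  let f : (Fin k → Fin m) × Fin k × Fin m → ℝ := fun p =>
    u p.1 p.2.1 (p.1 p.2.1) ^ 2 / s + s * u p.1 p.2.1 p.2.2 ^ 2
  have hf : ∑ p ∈ pairs k m, f p = s * ∑ x, ∑ b, ∑ v, u x b v ^ 2 := by
    rw [sum_pairs (fun x b v => u x b (x b) ^ 2 / s + s * u x b v ^ 2)]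
    simp only [Finset.mul_sum]
    refine Finset.sum_congr rfl fun x _ => Finset.sum_congr rfl fun b _ => ?_
    rw [Finset.sum_add_distrib, Finset.sum_const, Finset.card_univ, Fintype.card_fin,
      nsmul_eq_mul]
    have : (m : ℝ) = s * s + 1 := by linarith
    rw [this]
    field_simp
    ring
  calc _ ≤ ∑ p ∈ pairs k m, (f p + f (swap p)) := by
        refine Finset.sum_le_sum fun p _ => ?_
        have h1 := amgm (u p.1 p.2.1 (p.1 p.2.1)) (u (tgt p) p.2.1 (p.1 p.2.1))
        have h2 := amgm (u (tgt p) p.2.1 p.2.2) (u p.1 p.2.1 p.2.2)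
        have h3 : tgt p p.2.1 = p.2.2 := Function.update_self ..
        simp only [f, swap, h3]
        linarith
    _ = _ := by rw [Finset.sum_add_distrib, sum_swap, hf]; ring

/-- Position `v` of block `b`, as an index into the whole array. -/
def index (hkm : k * m ≤ n) (b : Fin k) (v : Fin m) : Fin n :=
  Fin.castLE hkm (finProdFinEquiv (b, v))

theorem index_val (hkm : k * m ≤ n) (b : Fin k) (v : Fin m) :
    (index hkm b v : ℕ) = v + m * b := rfl

theorem index_inj {hkm : k * m ≤ n} {b b' : Fin k} {v v' : Fin m} :
    index hkm b v = index hkm b' v' ↔ b = b' ∧ v = v' := by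
  simp [index, Fin.castLE_inj]

variable {A : Type u}

open Classical in
/-- The array whose elements are `lo` at position `x b` of every block `b`, and `hi` elsewhere. -/
noncomputable def array (lo hi : A) (hkm : k * m ≤ n) (x : Fin k → Fin m) (i : Fin n) : A :=
  if ∃ b, index hkm b (x b) = i then lo else hi

theorem array_index (lo hi : A) (hkm : k * m ≤ n) (x : Fin k → Fin m) (b : Fin k) (v : Fin m) :
    array lo hi hkm x (index hkm b v) = if v = x b then lo else hi := by
  simp only [array, index_inj, eq_comm (a := v)]
  simp

theorem array_tgt_ne {lo hi : A} {hkm : k * m ≤ n} {p : (Fin k → Fin m) × Fin k × Fin m}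
    {i : Fin n} (h : array lo hi hkm p.1 i ≠ array lo hi hkm (tgt p) i) :
    i = index hkm p.2.1 (p.1 p.2.1) ∨ i = index hkm p.2.1 p.2.2 := by
  by_contra! hi
  refine h ?_
  have : (∃ b, index hkm b (p.1 b) = i) ↔ ∃ b, index hkm b (tgt p b) = i := by
    refine exists_congr fun b => ?_
    by_cases hb : b = p.2.1
    · subst hb
      rw [tgt, Function.update_self]
      exact iff_of_false hi.1.symm hi.2.symm
    · rw [tgt, Function.update_of_ne hb]
  simp only [array, this]

/-- A block contains `lo` only once, so minimality alone determines the index, without the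
tie-breaking rule. -/
theorem isRMQ_array [LinearOrder A] {lo hi : A} (hlt : lo < hi) {hkm : k * m ≤ n}
    {x : Fin k → Fin m} {b : Fin k} {v v' : Fin m} (hv : (v : ℕ) = 0) (hv' : (v' : ℕ) + 1 = m)
    {i : Fin n} (h : Op.IsRMQ (array lo hi hkm x) (index hkm b v) (index hkm b v') i) :
    i = index hkm b (x b) := by
  obtain ⟨⟨h1, h2⟩, h3, -⟩ := h
  have hmem (w : Fin m) : index hkm b w ∈ Set.Icc (index hkm b v) (index hkm b v') := by
    constructor <;> rw [Fin.le_def, index_val, index_val] <;> omega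
  rw [Fin.le_def, index_val] at h1 h2
  obtain ⟨w, rfl⟩ : ∃ w, i = index hkm b w :=
    ⟨⟨i - m * b, by omega⟩, Fin.ext (by rw [index_val]; simp only; omega)⟩
  have := h3 _ (hmem (x b))
  rw [array_index, array_index, if_pos rfl] at this
  by_cases hw : w = x b
  · rw [hw]
  · rw [if_neg hw] at this
    exact absurd this (not_le.2 hlt)

open Classical in
/-- The adversary for the search of the minima of `k` blocks of length `m`. -/
noncomputable def adversary (hm : 2 ≤ m) (hkm : k * m ≤ n) (enc : A ↪ (β → Bool)) (lo hi : A) :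
    Adversary n β where
  X := Fin k → Fin m
  P := (Fin k → Fin m) × Fin k × Fin m
  pairs := pairs k m
  src := Prod.fst
  tgt := tgt
  inp x i := enc (array lo hi hkm x i)
  degree := k * (m - 1)
  sum_src g := sum_fst (by omega) g
  sum_tgt g := (sum_swap (fun p => g p.1)).trans (sum_fst (by omega) g)
  speed := 2 * √((m : ℝ) - 1)
  speed_nonneg := by positivity
  query_le w hw := by
    refine le_trans (Finset.sum_le_sum fun p hp => ?_) ((sum_mul_le hm fun x b v =>
      w x (index hkm b v)).trans ?_)
    · have hne : index hkm p.2.1 (p.1 p.2.1) ≠ index hkm p.2.1 p.2.2 := by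
        simp only [pairs, Finset.mem_filter] at hp
        simpa [index_inj] using Ne.symm hp.2
      rw [← Finset.sum_pair (f := fun i => 2 * (w p.1 i * w (tgt p) i)) hne]
      refine Finset.sum_le_sum_of_subset_of_nonneg (fun i hi' => ?_) fun i _ _ =>
        mul_nonneg zero_le_two (mul_nonneg (hw _ _) (hw _ _))
      have := (Finset.mem_filter.1 hi').2
      simpa using array_tgt_ne fun h => this (congrArg enc h)
    · refine mul_le_mul_of_nonneg_left (Finset.sum_le_sum fun x _ => ?_) (by positivity)
      rw [← Fintype.sum_prod_type' (f := fun b v => w x (index hkm b v) ^ 2)]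
      refine (Finset.sum_image (s := Finset.univ) (f := fun i => w x i ^ 2)
        (g := fun c : Fin k × Fin m => index hkm c.1 c.2) fun c _ c' _ h =>
        Prod.ext_iff.2 (index_inj.1 h)).symm.trans_le ?_
      exact Finset.sum_le_sum_of_subset_of_nonneg (Finset.subset_univ _) fun i _ _ =>
        sq_nonneg _

/-- An algorithm that answers `q` range minimum queries needs `Ω(k √(m - 1))` oracle calls if the
array has room for `k ≤ q` blocks of length `m`. -/
theorem le_queryComplexity [LinearOrder A] [Nontrivial A] {F : Submonoid (Function.End A)}
    {q : ℕ} {ε : ℝ} (hε : ε < 1 / 2) (enc : A ↪ (β → Bool)) (hk : 1 ≤ k) (hkq : k ≤ q)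
    (hm : 2 ≤ m) (hkm : k * m ≤ n) (alg : Algorithm n q F β Z) (halg : alg.Supports enc ε) {T : ℕ}
    (hT : alg.queryComplexity = T) :
    (1 - 2 * ε) ^ 2 / 4 * (k * √((m : ℝ) - 1)) ≤ T := by
  obtain ⟨lo, hi, hlt⟩ := exists_pair_lt A
  let G := adversary (n := n) hm hkm enc lo hi
  have : NeZero m := ⟨by omega⟩
  have : Nonempty G.X := ⟨fun _ => (0 : Fin m)⟩
  -- The surplus queries, from number `k` on, repeat the last block.
  let blk : Fin q → Fin k := fun t => ⟨min t (k - 1), by omega⟩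
  let first : Fin m := ⟨0, by omega⟩
  let last : Fin m := ⟨m - 1, by omega⟩
  have hlast : (last : ℕ) + 1 = m := Nat.sub_add_cancel (by omega)
  have key := G.le_queryComplexity (Z := Z) hε enc (fun x => array lo hi hkm x) (fun _ _ => rfl)
    (fun t => index hkm (blk t) first) (fun t => index hkm (blk t) last)
    (fun t => by
      rw [Fin.le_def, index_val, index_val]
      exact Nat.add_le_add_right (Nat.zero_le _) _)
    (fun p hp => by
      refine ⟨Fin.castLE hkq p.2.1, fun i hi' => ?_⟩
      have hb : blk (Fin.castLE hkq p.2.1) = p.2.1 := by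
        have := p.2.1.isLt
        exact Fin.ext (min_eq_left (by simp only [Fin.val_castLE]; omega))
      rw [hb] at hi'
      have h1 := isRMQ_array hlt rfl hlast hi'.1
      have h2 := isRMQ_array hlt rfl hlast hi'.2
      have h3 : p.1 p.2.1 = tgt p p.2.1 := (index_inj.1 (h1.symm.trans h2)).2
      exact (Finset.mem_filter.1 hp).2 (h3.trans (Function.update_self ..)).symm)
    alg halg hT
  have hm' : (2 : ℝ) ≤ m := by exact_mod_cast hm
  have hs : 0 < √((m : ℝ) - 1) := Real.sqrt_pos.2 (by linarith)
  have hs2 : √((m : ℝ) - 1) * √((m : ℝ) - 1) = m - 1 := Real.mul_self_sqrt (by linarith)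
  have hdeg : (G.degree : ℝ) = k * (√((m : ℝ) - 1) * √((m : ℝ) - 1)) := by
    rw [hs2, ← Nat.cast_pred (R := ℝ) (by omega : 0 < m)]
    exact_mod_cast rfl
  have hspeed : G.speed = 2 * √((m : ℝ) - 1) := rfl
  rw [hdeg, hspeed] at key
  refine le_of_mul_le_mul_left ?_ hs
  linarith

end BlockSearch

/-- The choice of the number `k` and the length `m` of the blocks. -/
theorem exists_blocks {n q : ℕ} {C : ℝ} (hn : 2 ≤ n) (hq : 1 ≤ q) (hC : 1 ≤ C)
    (hqC : (q : ℝ) ≤ C * n) :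
    ∃ k m : ℕ, 1 ≤ k ∧ k ≤ q ∧ 2 ≤ m ∧ k * m ≤ n ∧
      1 / (3 * √C) * √(n * q) ≤ k * √((m : ℝ) - 1) := by
  -- The cap `n / 2` guarantees blocks of length at least 2.
  let k := min q (n / 2)
  have hk : 1 ≤ k := by omega
  have hk2 : 2 * k ≤ n := by omega
  let m := n / k
  have hm : 2 ≤ m := (Nat.le_div_iff_mul_le hk).2 hk2
  have hkm : k * m ≤ n := Nat.mul_div_le n k
  refine ⟨k, m, hk, min_le_left _ _, hm, hkm, ?_⟩
  have hnm : n ≤ 3 * (k * (m - 1)) := by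
    have h1 : n < k * (m + 1) := Nat.lt_mul_div_succ n hk
    have h2 : k * (m + 1) ≤ k * (3 * (m - 1)) := Nat.mul_le_mul_left k (by omega)
    linarith
  have hnm' : (n : ℝ) ≤ 3 * (k * ((m : ℝ) - 1)) := by
    rw [← Nat.cast_pred (R := ℝ) (by omega : 0 < m)]
    exact_mod_cast hnm
  -- Either `k = q`, or `k = n / 2` rounded down, where `n ≤ 3 k` and `q ≤ C n` apply.
  have hqk : (q : ℝ) ≤ 3 * C * k := by
    rcases le_total q (n / 2) with h | h
    · have : k = q := min_eq_left h
      rw [this]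
      nlinarith [(Nat.cast_nonneg q : (0 : ℝ) ≤ q)]
    · have h3 : (n : ℝ) ≤ 3 * k := by
        have : n ≤ 3 * k := by omega
        exact_mod_cast this
      calc (q : ℝ) ≤ C * n := hqC
        _ ≤ C * (3 * k) := by gcongr
        _ = _ := by ring
  have hm' : (0 : ℝ) ≤ m - 1 := by
    have : (2 : ℝ) ≤ m := by exact_mod_cast hm
    linarith
  have hsC : 0 < √C := Real.sqrt_pos.2 (by linarith)
  rw [one_div_mul_eq_div, div_le_iff₀ (by positivity)]
  refine Real.sqrt_le_iff.2 ⟨by positivity, ?_⟩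
  calc (n : ℝ) * q ≤ 3 * (k * ((m : ℝ) - 1)) * (3 * C * k) := by gcongr
    _ = (k * √((m : ℝ) - 1) * (3 * √C)) ^ 2 := by
      rw [mul_pow, mul_pow, mul_pow, Real.sq_sqrt hm', Real.sq_sqrt (by linarith)]
      ring

end QRMQ

theorem theorem3p3 (ε C : ℝ) (hε : ε < 1 / 2) :
    ∃ c : ℝ, 0 < c ∧
      ∀ (A : Type u) [LinearOrder A] [Nontrivial A]
        (F : Submonoid (Function.End A))
        (_hF : ∀ f ∈ F, ∀ x y : A, (f : A → A) (min x y) = min ((f : A → A) x) ((f : A → A) y))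
        (β Z : Type u) (enc : A ↪ (β → Bool))
        (n q : ℕ) (_hn : 2 ≤ n) (_hq : (q : ℝ) ≤ C * n)
        (alg : QRMQ.Algorithm n q F β Z),
        alg.Supports enc ε →
          ENNReal.ofReal (c * Real.sqrt (n * q)) ≤ (alg.queryComplexity : ENNReal) := by
  have hε' : 0 < 1 - 2 * ε := by linarith
  -- Enlarging `C` to at least 1 covers the case `k = q` of `exists_blocks`.
  have hC : 1 ≤ max C 1 := le_max_right _ _
  refine ⟨(1 - 2 * ε) ^ 2 / 4 * (1 / (3 * √(max C 1))), by positivity, ?_⟩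
  intro A _ _ F _ β Z enc n q hn hqC alg halg
  rcases Nat.eq_zero_or_pos q with rfl | hq
  · simp
  obtain ⟨k, m, hk, hkq, hm, hkm, h⟩ := QRMQ.exists_blocks hn hq hC
    (hqC.trans (by gcongr; exact le_max_left _ _))
  by_cases htop : alg.queryComplexity = ⊤
  · simp [htop]
  obtain ⟨T, hT⟩ := ENat.ne_top_iff_exists.1 htop
  have hbound := QRMQ.BlockSearch.le_queryComplexity hε enc hk hkq hm hkm alg halg hT.symm
  rw [← hT, ENat.toENNReal_coe, ← ENNReal.ofReal_natCast]
  refine ENNReal.ofReal_le_ofReal (le_trans ?_ hbound)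
  rw [mul_assoc]
  gcongr
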